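/- Let $\mathcal M=(\mathcal S,\mathcal A,\iota,\tau,r,\gamma)$ be a Markov decision process with finite state and action spaces, initial-state distribution $\iota$, transition probabilities $\tau(s'\mid s,a)$, reward $r(s,a,s')\in\mathbb R$ and discount factor $\gamma\in[0,1)$. A policy is a function $\pi(a\mid s)\ge 0$ with $\sum_a\pi(a\mid s)=1$ for all $s$. Let $\bar r^\pi=(1-\gamma)\,\mathbb E\big[\sum_{t\ge0}\gamma^t r(s_t,a_t,s_{t+1})\big]$ be its average reward, $d^\pi(s)=(1-\gamma)\sum_{t\ge0}\gamma^t\,\mathbb P(s_t=s)$ and $p^\pi(s,a)=d^\pi(s)\pi(a\mid s)$ its visitation densities, where $s_0\sim\iota$, $a_t\sim\pi(\cdot\mid s_t)$, $s_{t+1}\sim\tau(\cdot\mid s_t,a_t)$. Let $\underline p,\overline p:\mathcal S\times\mathcal A\to\mathbb R$ be given bounds. An *optimal policy under the visitation density bounds* is a policy that maximizes $\bar r^\pi$ among all policies $\pi$ with $\underline p(s,a)\le p^\pi(s,a)\le\overline p(s,a)$ for all $s,a$. For a policy $\pi$, consider the constrained policy evaluation LP in its primal form $$\min_{v,q,\underline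 r,\overline r}\ \sum_s\iota(s)(1-\gamma)v(s)-\sum_{s,a}\underline r(s,a)\underline p(s,a)+\sum_{s,a}\overline r(s,a)\overline p(s,a)$$ subject to $v(s)\ge\sum_a\pi(a\mid s)q(s,a)$, $q(s,a)=\sum_{s'}\tau(s'\mid s,a)\big(r(s,a,s')+\underline r(s,a)-\overline r(s,a)+\gamma v(s')\big)$ and $\underline r,\overline r\ge0$, and in its dual form $$\max_{d,p}\ \sum_{s,a}p(s,a)\sum_{s'}\tau(s'\mid s,a)r(s,a,s')$$ subject to $d(s)=(1-\gamma)\iota(s)+\gamma\sum_{s',a'}p(s',a')\tau(s\mid s',a')\ge0$, $p(s,a)=d(s)\pi(a\mid s)$ and $\underline p(s,a)\le p(s,a)\le\overline p(s,a)$. Let $J(\pi)\in[-\infty,\infty]$ be the optimal value of either of these LPs ($-\infty$ if the primal is unbounded below, respectively if the dual is infeasible). The nested problem is to maximize $J(\pi)$ over all policies $\pi$; an optimal solution is a policy that attains the maximum with a value other than $-\infty$. Then, with the inner LP in primal form as well as with the inner LP in dual form: 1. A policy is an optimal solution of the nested problem if and only if it is an optimal policy under the visitation density bounds. 2. If some policy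 satisfies the bounds, then an optimal solution exists. 3. If $\iota(s)>0$ for all $s$, then for every optimal solution $\pi^\star$ of the nested problem there is an optimal solution $(v,q,\underline r,\overline r)$ of the primal LP of $\pi^\star$ such that $v$ and $q$ are the state and the state-action value function of $\pi^\star$ for the modified reward $r(s,a,s')+\underline r(s,a)-\overline r(s,a)$, they satisfy the Bellman optimality equation $v(s)=\max_a q(s,a)$ for all $s$, and $\pi^\star$ is greedy: $\pi^\star(a\mid s)>0$ implies $q(s,a)=\max_{a'}q(s,a')$. -/

import Mathlib

/-- A Markov decision process with finite state space `S` and finite action space `A`: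
initial-state distribution, transition distribution `trans s a s' = τ(s' | s, a)`,
reward `reward s a s' = r(s, a, s')` and discount factor in `[0, 1)`. -/
structure FiniteMDP (S A : Type*) [Fintype S] [Fintype A] where
  initDist : S → ℝ
  trans : S → A → S → ℝ
  reward : S → A → S → ℝ
  disc : ℝ
  initDist_nonneg : ∀ s, 0 ≤ initDist s
  initDist_sum : ∑ s, initDist s = 1
  trans_nonneg : ∀ s a s', 0 ≤ trans s a s'
  trans_sum : ∀ s a, ∑ s', trans s a s' = 1
  disc_nonneg : 0 ≤ disc
  disc_lt_one : disc < 1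

/-- `π s a = π(a | s)` is a conditional probability distribution over actions given states. -/
def IsPolicy {S A : Type*} [Fintype A] (π : S → A → ℝ) : Prop :=
  (∀ s, ∑ a, π s a = 1) ∧ ∀ s a, 0 ≤ π s a

/-- The variables `v, q, r_lower, r_upper` of the primal policy evaluation LP with bounds. -/
structure VDBPrimalVars (S A : Type*) where
  v : S → ℝ
  q : S → A → ℝ
  rLower : S → A → ℝ
  rUpper : S → A → ℝ

namespace FiniteMDP

/-- `P(s_t = s)` when `s_0 ∼ μ`, `a_k ∼ π(· | s_k)` and `s_{k+1} ∼ τ(· | s_k, a_k)`. -/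
def stateProb {S A : Type*} [Fintype S] [Fintype A] (M : FiniteMDP S A) (π : S → A → ℝ)
    (μ : S → ℝ) : ℕ → S → ℝ
  | 0 => μ
  | t + 1 => fun s => ∑ s', ∑ a', stateProb M π μ t s' * π s' a' * M.trans s' a' s

/-- `E[r(s_t, a_t, s_{t+1})]` when `s_0 ∼ μ` and the policy `π` is followed. -/
def expectedReward {S A : Type*} [Fintype S] [Fintype A] (M : FiniteMDP S A) (π : S → A → ℝ)
    (μ : S → ℝ) (t : ℕ) : ℝ :=
  ∑ s, ∑ a, ∑ s', M.stateProb π μ t s * π s a * M.trans s a s' * M.reward s a s'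

/-- The expected discounted return `∑ γ^t E[r(s_t, a_t, s_{t+1})]` when `s_0 ∼ μ`. -/
noncomputable def expectedReturn {S A : Type*} [Fintype S] [Fintype A] (M : FiniteMDP S A)
    (π : S → A → ℝ) (μ : S → ℝ) : ℝ :=
  ∑' t : ℕ, M.disc ^ t * M.expectedReward π μ t

/-- The average reward `(1 - γ) ν^π` of the policy `π`. -/
noncomputable def avgReward {S A : Type*} [Fintype S] [Fintype A] (M : FiniteMDP S A)
    (π : S → A → ℝ) : ℝ :=
  (1 - M.disc) * M.expectedReturn π M.initDist

open Classical in
/-- The state value function `v^π(s)`: the expected discounted return given `s_0 = s`. -/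
noncomputable def stateValue {S A : Type*} [Fintype S] [Fintype A] (M : FiniteMDP S A)
    (π : S → A → ℝ) (s : S) : ℝ :=
  M.expectedReturn π (fun s' => if s' = s then 1 else 0)

/-- The state-action value function `q^π(s, a)`: the expected discounted return given `s_0 = s`
and `a_0 = a`. The first reward is `E[r(s, a, s_1)]`, and from `s_1 ∼ τ(· | s, a)` on the
policy is followed. -/
noncomputable def actionValue {S A : Type*} [Fintype S] [Fintype A] (M : FiniteMDP S A)
    (π : S → A → ℝ) (s : S) (a : A) : ℝ :=
  ∑ s', M.trans s a s' * M.reward s a s'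
    + ∑' t : ℕ, M.disc ^ (t + 1) * M.expectedReward π (M.trans s a) t

/-- The discounted state visitation density `d^π`. -/
noncomputable def stateVisit {S A : Type*} [Fintype S] [Fintype A] (M : FiniteMDP S A)
    (π : S → A → ℝ) (s : S) : ℝ :=
  (1 - M.disc) * ∑' t : ℕ, M.disc ^ t * M.stateProb π M.initDist t s

/-- The discounted state-action visitation density `p^π(s, a) = d^π(s) π(a | s)`. -/
noncomputable def actionVisit {S A : Type*} [Fintype S] [Fintype A] (M : FiniteMDP S A)
    (π : S → A → ℝ) (s : S) (a : A) : ℝ :=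
  M.stateVisit π s * π s a

/-- `π` is a policy whose state-action visitation density satisfies the bounds. -/
def IsVDBFeasible {S A : Type*} [Fintype S] [Fintype A] (M : FiniteMDP S A)
    (lb ub : S → A → ℝ) (π : S → A → ℝ) : Prop :=
  IsPolicy π ∧ ∀ s a, lb s a ≤ M.actionVisit π s a ∧ M.actionVisit π s a ≤ ub s a

/-- `π` is an optimal policy of the MDP with visitation density bounds: it maximizes the average
reward among all policies that satisfy the bounds. -/
def IsVDBOptimal {S A : Type*} [Fintype S] [Fintype A] (M : FiniteMDP S A)
    (lb ub : S → A → ℝ) (π : S → A → ℝ) : Prop :=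
  M.IsVDBFeasible lb ub π ∧ ∀ π', M.IsVDBFeasible lb ub π' → M.avgReward π' ≤ M.avgReward π

/-- The same MDP with the modified reward `r(s, a, s') + r_lower(s, a) - r_upper(s, a)`. -/
def modifyReward {S A : Type*} [Fintype S] [Fintype A] (M : FiniteMDP S A)
    (rLower rUpper : S → A → ℝ) : FiniteMDP S A :=
  { M with reward := fun s a s' => M.reward s a s' + rLower s a - rUpper s a }

/-- The constraints of the primal policy evaluation LP with bounds, for the policy `π`. -/
def VDBPrimalFeasible {S A : Type*} [Fintype S] [Fintype A] (M : FiniteMDP S A)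
    (π : S → A → ℝ) (x : VDBPrimalVars S A) : Prop :=
  (∀ s, ∑ a, π s a * x.q s a ≤ x.v s) ∧
  (∀ s a, x.q s a = ∑ s', M.trans s a s' *
    (M.reward s a s' + x.rLower s a - x.rUpper s a + M.disc * x.v s')) ∧
  ∀ s a, 0 ≤ x.rLower s a ∧ 0 ≤ x.rUpper s a

/-- The objective of the primal policy evaluation LP with bounds. -/
def vdbPrimalObj {S A : Type*} [Fintype S] [Fintype A] (M : FiniteMDP S A)
    (lb ub : S → A → ℝ) (x : VDBPrimalVars S A) : ℝ :=
  ∑ s, M.initDist s * ((1 - M.disc) * x.v s)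
    - ∑ s, ∑ a, x.rLower s a * lb s a + ∑ s, ∑ a, x.rUpper s a * ub s a

/-- `x` attains the minimum of the primal policy evaluation LP with bounds. -/
def IsVDBPrimalOptimal {S A : Type*} [Fintype S] [Fintype A] (M : FiniteMDP S A)
    (lb ub : S → A → ℝ) (π : S → A → ℝ) (x : VDBPrimalVars S A) : Prop :=
  M.VDBPrimalFeasible π x ∧
    ∀ y, M.VDBPrimalFeasible π y → M.vdbPrimalObj lb ub x ≤ M.vdbPrimalObj lb ub y

/-- The optimal value of the primal LP, which is `⊥ = -∞` if the LP is unbounded below. -/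
noncomputable def vdbPrimalValue {S A : Type*} [Fintype S] [Fintype A] (M : FiniteMDP S A)
    (lb ub : S → A → ℝ) (π : S → A → ℝ) : EReal :=
  ⨅ (x : VDBPrimalVars S A) (_ : M.VDBPrimalFeasible π x), (M.vdbPrimalObj lb ub x : EReal)

/-- The constraints of the dual policy evaluation LP with bounds, for the policy `π`. -/
def VDBDualFeasible {S A : Type*} [Fintype S] [Fintype A] (M : FiniteMDP S A)
    (lb ub : S → A → ℝ) (π : S → A → ℝ) (d : S → ℝ) (p : S → A → ℝ) : Prop :=
  (∀ s, d s = (1 - M.disc) * M.initDist s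
    + M.disc * ∑ s', ∑ a', p s' a' * M.trans s' a' s) ∧
  (∀ s, 0 ≤ d s) ∧
  (∀ s a, p s a = d s * π s a) ∧
  ∀ s a, lb s a ≤ p s a ∧ p s a ≤ ub s a

/-- The objective of the dual policy evaluation LP with bounds. -/
def vdbDualObj {S A : Type*} [Fintype S] [Fintype A] (M : FiniteMDP S A) (p : S → A → ℝ) : ℝ :=
  ∑ s, ∑ a, p s a * ∑ s', M.trans s a s' * M.reward s a s'

/-- The optimal value of the dual LP, which is `⊥ = -∞` if the LP is infeasible. -/
noncomputable def vdbDualValue {S A : Type*} [Fintype S] [Fintype A] (M : FiniteMDP S A)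
    (lb ub : S → A → ℝ) (π : S → A → ℝ) : EReal :=
  ⨆ (d : S → ℝ) (p : S → A → ℝ) (_ : M.VDBDualFeasible lb ub π d p), (M.vdbDualObj p : EReal)

end FiniteMDP

/-- `π` is an optimal solution of the policy optimization problem `max J(π)` over all policies,
where `J π` is the optimal value of an inner problem. As usual, a point at which the value of the
maximization problem is `-∞` (the inner problem fails) does not count as a solution. -/
def IsPOOptimal {S A : Type*} [Fintype A] (J : (S → A → ℝ) → EReal) (π : S → A → ℝ) : Prop :=
  IsPolicy π ∧ J π ≠ ⊥ ∧ ∀ π', IsPolicy π' → J π' ≤ J π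

/-! For a fixed policy the flow equations have one solution, because a discounted transition step
contracts the l1 norm. So the dual LP either has the single feasible point `(d^π, p^π)` or none, and
its value is the average reward or `⊥`. The primal takes the same values: by `vdbPrimalObj_eq` its
objective is the average reward plus slackness terms. These are nonnegative when the bounds hold and
vanish for suitable variables; if a bound is violated, the multiplier of that bound drives the
objective to `-∞`. Both forms of the nested problem are thus bounded policy optimization
(`isPOOptimal_iff`).

Existence follows by maximizing the linear reward over the compact set of occupancy measures, each
of which comes from a policy.

For greediness, an optimal `π` maximizes the reward over all occupancy measures, not only over those
compatible with `π`. Farkas' lemma on the active constraints (`exists_multipliers`) gives `v`, the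
reward modifications and a slack `v - q ≥ 0` complementary to `p^π`. Positive initial probabilities
make `d^π > 0`, so the slack vanishes wherever `π > 0`. -/

open Filter Topology

/-! ### Farkas' lemma. -/

/-- Farkas' lemma for finitely many linear functionals on a real vector space. -/
theorem farkas_fin {V : Type*} [AddCommGroup V] [Module ℝ V] (n : ℕ) :
    ∀ (f : Fin n → V →ₗ[ℝ] ℝ) (g : V →ₗ[ℝ] ℝ),
      (∀ x, (∀ i, f i x ≤ 0) → g x ≤ 0) →
      ∃ c : Fin n → ℝ, (∀ i, 0 ≤ c i) ∧ ∀ x, g x = ∑ i, c i * f i x := by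
  induction n with
  | zero =>
    intro f g h
    refine ⟨fun _ => 0, fun _ => le_rfl, fun x => ?_⟩
    have h1 := h x (fun i => i.elim0)
    have h2 := h (-x) (fun i => i.elim0)
    rw [map_neg] at h2
    simp only [Finset.univ_eq_empty, Finset.sum_empty]
    linarith
  | succ n ih =>
    intro f g h
    by_cases h0 : ∀ x, (∀ i : Fin n, f i.succ x ≤ 0) → g x ≤ 0
    · obtain ⟨c, hc, hg⟩ := ih (fun i => f i.succ) g h0
      refine ⟨Fin.cons 0 c, fun i => ?_, fun x => ?_⟩
      · refine Fin.cases ?_ (fun j => ?_) i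
        · simp
        · simpa using hc j
      · simp [Fin.sum_univ_succ, hg x]
    · push Not at h0
      -- The first constraint is needed to exclude `z`, so `f 0 z > 0`. Projecting along `z` onto
      -- the kernel of `f 0` leaves `n` functionals for the induction.
      obtain ⟨z, hz, hgz⟩ := h0
      have hfz : 0 < f 0 z := by
        by_contra hcon
        exact absurd (h z (Fin.cases (not_lt.mp hcon) hz)) (not_le.mpr hgz)
      obtain ⟨c, hc, hg⟩ := ih (fun i => f i.succ - (f i.succ z / f 0 z) • f 0)
        (g - (g z / f 0 z) • f 0) (fun x hx => by
          have h1 := h (x - (f 0 x / f 0 z) • z) (Fin.cases (by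
            simp only [map_sub, map_smul, smul_eq_mul]
            rw [div_mul_cancel₀ _ hfz.ne']; simp) (fun i => by
            have := hx i
            simp only [LinearMap.sub_apply, LinearMap.smul_apply, smul_eq_mul, map_sub,
              map_smul] at this ⊢
            calc _ = f i.succ x - f i.succ z / f 0 z * f 0 x := by ring
              _ ≤ 0 := this))
          simp only [LinearMap.sub_apply, LinearMap.smul_apply, smul_eq_mul, map_sub,
              map_smul] at h1 ⊢
          calc _ = g x - f 0 x / f 0 z * g z := by ring
            _ ≤ 0 := h1)
      refine ⟨Fin.cons (g z / f 0 z - ∑ i, c i * (f i.succ z / f 0 z)) c, fun i => ?_,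
        fun x => ?_⟩
      · refine Fin.cases ?_ (fun j => ?_) i
        · simp only [Fin.cons_zero]
          have h1 : ∑ i, c i * (f i.succ z / f 0 z) ≤ 0 := Finset.sum_nonpos fun i _ =>
            mul_nonpos_of_nonneg_of_nonpos (hc i) (div_nonpos_of_nonpos_of_nonneg (hz i) hfz.le)
          have h2 : 0 < g z / f 0 z := div_pos hgz hfz
          linarith
        · simpa using hc j
      · have := hg x
        simp only [LinearMap.sub_apply, LinearMap.smul_apply, smul_eq_mul, mul_sub,
          Finset.sum_sub_distrib] at this
        simp only [Fin.sum_univ_succ, Fin.cons_zero, Fin.cons_succ, sub_mul, Finset.sum_mul]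
        simp only [mul_assoc] at this ⊢
        linarith

theorem farkas {V ι : Type*} [AddCommGroup V] [Module ℝ V] [Fintype ι]
    (f : ι → V →ₗ[ℝ] ℝ) (g : V →ₗ[ℝ] ℝ) (h : ∀ x, (∀ i, f i x ≤ 0) → g x ≤ 0) :
    ∃ c : ι → ℝ, (∀ i, 0 ≤ c i) ∧ ∀ x, g x = ∑ i, c i * f i x := by
  let e := Fintype.equivFin ι
  obtain ⟨c, hc, hg⟩ := farkas_fin _ (fun i => f (e.symm i)) g
    (fun x hx => h x fun i => by simpa using hx (e i))
  refine ⟨fun i => c (e i), fun i => hc _, fun x => ?_⟩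
  rw [hg x, ← e.sum_comp]
  simp

namespace FiniteMDP

variable {S A : Type*} [Fintype S] [Fintype A] (M : FiniteMDP S A)

/-! ### Visitation densities and flow equations. -/

/-- The state distribution after one step from state weights `μ` under `π`. -/
def push (π : S → A → ℝ) (μ : S → ℝ) (s : S) : ℝ :=
  ∑ s', ∑ a', μ s' * π s' a' * M.trans s' a' s

/-- Triangle inequality, then `π` and `trans` sum to one. This drives both the convergence of the
discounted series and the uniqueness of visitation densities. -/
theorem sum_abs_push_le {π : S → A → ℝ} (hπ : IsPolicy π) (μ : S → ℝ) :
    ∑ s, |M.push π μ s| ≤ ∑ s, |μ s| := by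
  calc ∑ s, |M.push π μ s|
      ≤ ∑ s, ∑ s', ∑ a', |μ s'| * π s' a' * M.trans s' a' s := by
        refine Finset.sum_le_sum fun s _ => (Finset.abs_sum_le_sum_abs _ _).trans ?_
        refine Finset.sum_le_sum fun s' _ => (Finset.abs_sum_le_sum_abs _ _).trans ?_
        refine Finset.sum_le_sum fun a' _ => ?_
        rw [abs_mul, abs_mul, abs_of_nonneg (hπ.2 s' a'), abs_of_nonneg (M.trans_nonneg _ _ _)]
    _ = ∑ s', |μ s'| := by
        rw [Finset.sum_comm]
        refine Finset.sum_congr rfl fun s' _ => ?_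
        rw [Finset.sum_comm]
        simp only [← Finset.mul_sum, M.trans_sum, mul_one, hπ.1]

theorem stateProb_succ (π : S → A → ℝ) (μ : S → ℝ) (t : ℕ) :
    M.stateProb π μ (t + 1) = M.push π (M.stateProb π μ t) := rfl

theorem sum_abs_stateProb_le {π : S → A → ℝ} (hπ : IsPolicy π) (μ : S → ℝ) (t : ℕ) :
    ∑ s, |M.stateProb π μ t s| ≤ ∑ s, |μ s| := by
  induction t with
  | zero => exact le_rfl
  | succ t ih => exact (M.sum_abs_push_le hπ _).trans ih

theorem abs_stateProb_le {π : S → A → ℝ} (hπ : IsPolicy π) (μ : S → ℝ) (t : ℕ) (s : S) :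
    |M.stateProb π μ t s| ≤ ∑ s, |μ s| :=
  (Finset.single_le_sum (f := fun s => |M.stateProb π μ t s|) (fun _ _ => abs_nonneg _)
    (Finset.mem_univ s)).trans (M.sum_abs_stateProb_le hπ μ t)

theorem stateProb_nonneg {π : S → A → ℝ} (hπ : IsPolicy π) {μ : S → ℝ} (hμ : ∀ s, 0 ≤ μ s)
    (t : ℕ) : ∀ s, 0 ≤ M.stateProb π μ t s := by
  induction t with
  | zero => exact hμ
  | succ t ih =>
    exact fun s => Finset.sum_nonneg fun s' _ => Finset.sum_nonneg fun a' _ =>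
      mul_nonneg (mul_nonneg (ih s') (hπ.2 _ _)) (M.trans_nonneg _ _ _)

theorem summable_stateProb {π : S → A → ℝ} (hπ : IsPolicy π) (μ : S → ℝ) (s : S) :
    Summable fun t => M.disc ^ t * M.stateProb π μ t s := by
  refine Summable.of_norm_bounded
    ((summable_geometric_of_lt_one M.disc_nonneg M.disc_lt_one).mul_right (∑ s, |μ s|))
    fun t => ?_
  rw [Real.norm_eq_abs, abs_mul, abs_of_nonneg (pow_nonneg M.disc_nonneg t)]
  exact mul_le_mul_of_nonneg_left (M.abs_stateProb_le hπ μ t s) (pow_nonneg M.disc_nonneg t)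

/-- The term `t = 0` gives the initial distribution; the shifted series is one discounted step
applied to the whole series. -/
theorem stateVisit_flow {π : S → A → ℝ} (hπ : IsPolicy π) (s : S) :
    M.stateVisit π s = (1 - M.disc) * M.initDist s
      + M.disc * ∑ s', ∑ a', M.actionVisit π s' a' * M.trans s' a' s := by
  unfold actionVisit stateVisit
  rw [(M.summable_stateProb hπ M.initDist s).tsum_eq_zero_add]
  have hs : ∀ s' a', Summable fun t =>
      M.disc ^ t * M.stateProb π M.initDist t s' * (π s' a' * M.trans s' a' s) :=
    fun s' a' => (M.summable_stateProb hπ M.initDist s').mul_right _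
  have h : ∑' t, M.disc ^ (t + 1) * M.stateProb π M.initDist (t + 1) s
      = M.disc * ∑ s', ∑ a',
        (∑' t, M.disc ^ t * M.stateProb π M.initDist t s') * (π s' a' * M.trans s' a' s) := by
    simp only [← tsum_mul_right]
    simp only [← Summable.tsum_finsetSum (fun a' _ => hs _ a')]
    rw [← Summable.tsum_finsetSum (fun s' _ => summable_sum fun a' _ => hs s' a'),
      ← tsum_mul_left]
    refine tsum_congr fun t => ?_
    rw [stateProb_succ, push, pow_succ', mul_assoc, Finset.mul_sum]
    simp only [Finset.mul_sum]
    refine Finset.sum_congr rfl fun s' _ => Finset.sum_congr rfl fun a' _ => by ring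
  rw [h, mul_add]
  simp only [pow_zero, one_mul, stateProb, Finset.mul_sum]
  congr 1
  refine Finset.sum_congr rfl fun s' _ => Finset.sum_congr rfl fun a' _ => by ring

theorem stateVisit_nonneg {π : S → A → ℝ} (hπ : IsPolicy π) (s : S) : 0 ≤ M.stateVisit π s :=
  mul_nonneg (sub_nonneg.mpr M.disc_lt_one.le) (tsum_nonneg fun t =>
    mul_nonneg (pow_nonneg M.disc_nonneg t) (M.stateProb_nonneg hπ M.initDist_nonneg t s))

theorem actionVisit_nonneg {π : S → A → ℝ} (hπ : IsPolicy π) (s : S) (a : A) :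
    0 ≤ M.actionVisit π s a := mul_nonneg (M.stateVisit_nonneg hπ s) (hπ.2 s a)

theorem sum_actionVisit {π : S → A → ℝ} (hπ : IsPolicy π) (s : S) :
    ∑ a, M.actionVisit π s a = M.stateVisit π s := by
  simp only [actionVisit, ← Finset.mul_sum, hπ.1, mul_one]

/-- The visitation density is the only solution of the flow equations. -/
theorem eq_stateVisit {π : S → A → ℝ} (hπ : IsPolicy π) {d : S → ℝ}
    (hd : ∀ s, d s = (1 - M.disc) * M.initDist s
      + M.disc * ∑ s', ∑ a', d s' * π s' a' * M.trans s' a' s) : d = M.stateVisit π := by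
  -- The difference of two solutions is reproduced by a discounted step, so its l1 norm is at most
  -- `disc` times itself.
  have he : ∀ s, d s - M.stateVisit π s
      = M.disc * M.push π (fun s' => d s' - M.stateVisit π s') s := by
    intro s
    rw [hd s, M.stateVisit_flow hπ s]
    simp only [push, actionVisit, sub_mul, Finset.sum_sub_distrib]
    ring
  have h1 : ∑ s, |d s - M.stateVisit π s| ≤ M.disc * ∑ s, |d s - M.stateVisit π s| := by
    calc ∑ s, |d s - M.stateVisit π s|
        = M.disc * ∑ s, |M.push π (fun s' => d s' - M.stateVisit π s') s| := by
          rw [Finset.mul_sum]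
          refine Finset.sum_congr rfl fun s _ => ?_
          rw [he s, abs_mul, abs_of_nonneg M.disc_nonneg]
      _ ≤ _ := mul_le_mul_of_nonneg_left (M.sum_abs_push_le hπ _) M.disc_nonneg
  have h2 : ∑ s, |d s - M.stateVisit π s| = 0 :=
    le_antisymm (by nlinarith [M.disc_lt_one]) (Finset.sum_nonneg fun _ _ => abs_nonneg _)
  ext s
  have := (Finset.sum_eq_zero_iff_of_nonneg (fun _ _ => abs_nonneg _)).mp h2 s (Finset.mem_univ s)
  exact sub_eq_zero.mp (abs_eq_zero.mp this)

/-! ### Bellman evaluation equation. -/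

/-- A solution of the Bellman evaluation equation computes all expected returns. -/
theorem hasSum_expectedReward {π : S → A → ℝ} (hπ : IsPolicy π) {v : S → ℝ}
    (hv : ∀ s, v s = ∑ a, π s a * ∑ s', M.trans s a s' * (M.reward s a s' + M.disc * v s'))
    (μ : S → ℝ) :
    HasSum (fun t => M.disc ^ t * M.expectedReward π μ t) (∑ s, μ s * v s) := by
  -- `V t` is the mean of `v` at time `t`. The Bellman equation makes the discounted rewards
  -- telescope to `V 0`.
  set V : ℕ → ℝ := fun t => ∑ s, M.stateProb π μ t s * v s with hV
  have hrew : ∀ t, M.expectedReward π μ t = V t - M.disc * V (t + 1) := by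
    intro t
    have h1 : V t = ∑ s, ∑ a, ∑ s', M.stateProb π μ t s * π s a * M.trans s a s'
        * (M.reward s a s' + M.disc * v s') := by
      refine Finset.sum_congr rfl fun s _ => ?_
      rw [hv s]
      simp only [Finset.mul_sum]
      refine Finset.sum_congr rfl fun a _ => Finset.sum_congr rfl fun s' _ => by ring
    have h2 : V (t + 1) = ∑ s, ∑ a, ∑ s', M.stateProb π μ t s * π s a * M.trans s a s'
        * v s' := by
      simp only [hV, stateProb_succ, push, Finset.sum_mul]
      rw [Finset.sum_comm]
      exact Finset.sum_congr rfl fun s _ => Finset.sum_comm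
    rw [h1, h2, expectedReward]
    simp only [Finset.mul_sum, ← Finset.sum_sub_distrib]
    refine Finset.sum_congr rfl fun s _ => Finset.sum_congr rfl fun a _ =>
      Finset.sum_congr rfl fun s' _ => by ring
  have hsum : Summable fun t => M.disc ^ t * V t := by
    simp only [hV, Finset.mul_sum]
    refine summable_sum fun s _ => ?_
    simpa only [mul_assoc] using (M.summable_stateProb hπ μ s).mul_right (v s)
  have h3 := hsum.hasSum.sub ((summable_nat_add_iff 1).mpr hsum).hasSum
  rw [hsum.tsum_eq_zero_add, add_sub_cancel_right] at h3
  have h4 : (fun t => M.disc ^ t * M.expectedReward π μ t)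
      = fun t => M.disc ^ t * V t - M.disc ^ (t + 1) * V (t + 1) := by
    ext t
    rw [hrew, pow_succ]
    ring
  rw [h4]
  simpa [V, stateProb] using h3

/-- The identity minus the discounted transition operator is injective by a sup-norm estimate, hence
surjective in finite dimension. -/
theorem exists_bellman {π : S → A → ℝ} (hπ : IsPolicy π) :
    ∃ v : S → ℝ, ∀ s, v s
      = ∑ a, π s a * ∑ s', M.trans s a s' * (M.reward s a s' + M.disc * v s') := by
  let T : (S → ℝ) →ₗ[ℝ] (S → ℝ) :=
    { toFun := fun v s => v s - M.disc * ∑ a, π s a * ∑ s', M.trans s a s' * v s'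
      map_add' := fun v w => by
        ext s
        simp only [Pi.add_apply, mul_add, Finset.sum_add_distrib]
        ring
      map_smul' := fun c v => by
        ext s
        simp only [Pi.smul_apply, smul_eq_mul, RingHom.id_apply, Finset.mul_sum, mul_sub]
        congr 1
        refine Finset.sum_congr rfl fun a _ => Finset.sum_congr rfl fun s' _ => by ring }
  have hinj : Function.Injective T := by
    rw [← LinearMap.ker_eq_bot, LinearMap.ker_eq_bot']
    intro v hv
    have hv' : ∀ s, v s = M.disc * ∑ a, π s a * ∑ s', M.trans s a s' * v s' := fun s =>
      sub_eq_zero.mp (congrFun hv s)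
    have hb : ∀ s, ‖v s‖ ≤ M.disc * ‖v‖ := by
      intro s
      rw [hv' s, norm_mul, Real.norm_of_nonneg M.disc_nonneg]
      refine mul_le_mul_of_nonneg_left ?_ M.disc_nonneg
      calc ‖∑ a, π s a * ∑ s', M.trans s a s' * v s'‖
          ≤ ∑ a, π s a * ∑ s', M.trans s a s' * ‖v‖ := by
            refine (norm_sum_le _ _).trans (Finset.sum_le_sum fun a _ => ?_)
            rw [norm_mul, Real.norm_of_nonneg (hπ.2 s a)]
            refine mul_le_mul_of_nonneg_left ?_ (hπ.2 s a)
            refine (norm_sum_le _ _).trans (Finset.sum_le_sum fun s' _ => ?_)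
            rw [norm_mul, Real.norm_of_nonneg (M.trans_nonneg _ _ _)]
            exact mul_le_mul_of_nonneg_left (norm_le_pi_norm v s') (M.trans_nonneg _ _ _)
        _ = ‖v‖ := by simp only [← Finset.sum_mul, M.trans_sum, one_mul, hπ.1]
    have h1 : ‖v‖ ≤ M.disc * ‖v‖ :=
      (pi_norm_le_iff_of_nonneg (mul_nonneg M.disc_nonneg (norm_nonneg v))).mpr hb
    exact norm_le_zero_iff.mp (by nlinarith [M.disc_lt_one])
  obtain ⟨v, hv⟩ := LinearMap.injective_iff_surjective.mp hinj
    (fun s => ∑ a, π s a * ∑ s', M.trans s a s' * M.reward s a s')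
  refine ⟨v, fun s => ?_⟩
  have := congrFun hv s
  simp only [T, LinearMap.coe_mk, AddHom.coe_mk] at this
  rw [sub_eq_iff_eq_add.mp this]
  simp only [mul_add, Finset.sum_add_distrib, Finset.mul_sum]
  congr 1
  refine Finset.sum_congr rfl fun a _ => Finset.sum_congr rfl fun s' _ => by ring

theorem stateValue_eq {π : S → A → ℝ} (hπ : IsPolicy π) {v : S → ℝ}
    (hv : ∀ s, v s = ∑ a, π s a * ∑ s', M.trans s a s' * (M.reward s a s' + M.disc * v s')) :
    M.stateValue π = v := by
  ext s
  rw [stateValue, expectedReturn, (M.hasSum_expectedReward hπ hv _).tsum_eq, Finset.sum_eq_single s] <;> simp +contextual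

theorem actionValue_eq {π : S → A → ℝ} (hπ : IsPolicy π) {v : S → ℝ}
    (hv : ∀ s, v s = ∑ a, π s a * ∑ s', M.trans s a s' * (M.reward s a s' + M.disc * v s'))
    (s : S) (a : A) :
    M.actionValue π s a = ∑ s', M.trans s a s' * (M.reward s a s' + M.disc * v s') := by
  have h := (M.hasSum_expectedReward hπ hv (M.trans s a)).mul_left M.disc
  simp only [← mul_assoc, ← pow_succ'] at h
  rw [actionValue, h.tsum_eq]
  simp only [mul_add, Finset.sum_add_distrib, Finset.mul_sum]
  congr 1
  refine Finset.sum_congr rfl fun s' _ => by ring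

/-! ### Duality and the values of the inner LPs. -/

/-- The flow equations tested against `v`; no policy needs to link `d` and `p`. -/
theorem sum_initDist_of_flow {d : S → ℝ} {p : S → A → ℝ}
    (hd : ∀ s, d s = (1 - M.disc) * M.initDist s
      + M.disc * ∑ s', ∑ a', p s' a' * M.trans s' a' s) (v : S → ℝ) :
    ∑ s, M.initDist s * ((1 - M.disc) * v s)
      = ∑ s, d s * v s - ∑ s, ∑ a, p s a * ∑ s', M.trans s a s' * (M.disc * v s') := by
  have h : ∑ s, ∑ a, p s a * ∑ s', M.trans s a s' * (M.disc * v s')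
      = ∑ s, M.disc * (∑ s', ∑ a', p s' a' * M.trans s' a' s) * v s := by
    simp only [Finset.mul_sum, Finset.sum_mul]
    rw [Finset.sum_comm' (t' := Finset.univ) (s' := fun _ => Finset.univ) (by simp)]
    rw [Finset.sum_comm]
    rw [Finset.sum_comm (s := Finset.univ (α := S)) (t := Finset.univ (α := S))]
    refine Finset.sum_congr rfl fun s _ => ?_
    rw [Finset.sum_comm]
    refine Finset.sum_congr rfl fun s' _ => Finset.sum_congr rfl fun a _ => by ring
  rw [h, ← Finset.sum_sub_distrib]
  refine Finset.sum_congr rfl fun s _ => ?_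
  rw [hd s]
  ring

/-- Testing the flow equations against the Bellman solution cancels the discounted values and leaves
the rewards. -/
theorem avgReward_eq {π : S → A → ℝ} (hπ : IsPolicy π) :
    M.avgReward π = M.vdbDualObj (M.actionVisit π) := by
  obtain ⟨v, hv⟩ := M.exists_bellman hπ
  have h1 : M.avgReward π = ∑ s, M.initDist s * ((1 - M.disc) * v s) := by
    rw [avgReward, expectedReturn, (M.hasSum_expectedReward hπ hv _).tsum_eq, Finset.mul_sum]
    exact Finset.sum_congr rfl fun s _ => by ring
  rw [h1, M.sum_initDist_of_flow (M.stateVisit_flow hπ), vdbDualObj, ← Finset.sum_sub_distrib]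
  refine Finset.sum_congr rfl fun s _ => ?_
  rw [hv s, Finset.mul_sum, ← Finset.sum_sub_distrib]
  refine Finset.sum_congr rfl fun a _ => ?_
  rw [← mul_assoc, ← actionVisit, ← mul_sub]
  simp only [mul_add, Finset.sum_add_distrib, add_sub_cancel_right]

/-- The primal objective exceeds the average reward by the complementary slackness terms. -/
theorem vdbPrimalObj_eq {π : S → A → ℝ} (hπ : IsPolicy π) (lb ub : S → A → ℝ)
    {x : VDBPrimalVars S A}
    (hq : ∀ s a, x.q s a = ∑ s', M.trans s a s' *
      (M.reward s a s' + x.rLower s a - x.rUpper s a + M.disc * x.v s')) :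
    M.vdbPrimalObj lb ub x = M.avgReward π
      + ∑ s, M.stateVisit π s * (x.v s - ∑ a, π s a * x.q s a)
      + ∑ s, ∑ a, x.rLower s a * (M.actionVisit π s a - lb s a)
      + ∑ s, ∑ a, x.rUpper s a * (ub s a - M.actionVisit π s a) := by
  have hq' : ∀ s a, x.q s a = ∑ s', M.trans s a s' * M.reward s a s' + x.rLower s a
      - x.rUpper s a + ∑ s', M.trans s a s' * (M.disc * x.v s') := by
    intro s a
    rw [hq s a]
    simp only [mul_add, mul_sub, Finset.sum_add_distrib, Finset.sum_sub_distrib,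
      ← Finset.sum_mul, M.trans_sum, one_mul]
  rw [vdbPrimalObj, M.avgReward_eq hπ, M.sum_initDist_of_flow (M.stateVisit_flow hπ), vdbDualObj]
  simp only [← Finset.sum_sub_distrib, ← Finset.sum_add_distrib]
  refine Finset.sum_congr rfl fun s _ => ?_
  have h : M.stateVisit π s * ∑ a, π s a * x.q s a
      = ∑ a, (M.actionVisit π s a * ∑ s', M.trans s a s' * M.reward s a s')
        + ∑ a, x.rLower s a * M.actionVisit π s a - ∑ a, x.rUpper s a * M.actionVisit π s a
        + ∑ a, M.actionVisit π s a * ∑ s', M.trans s a s' * (M.disc * x.v s') := by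
    rw [Finset.mul_sum]
    simp only [← Finset.sum_sub_distrib, ← Finset.sum_add_distrib]
    refine Finset.sum_congr rfl fun a _ => ?_
    rw [← mul_assoc, ← actionVisit, hq' s a]
    ring
  simp only [mul_sub, Finset.sum_sub_distrib]
  linarith

/-- Substituting `p = d π` into the flow constraint leaves the equation solved only by the
visitation density. -/
theorem vdbDualFeasible_iff {π : S → A → ℝ} (hπ : IsPolicy π) (lb ub : S → A → ℝ)
    (d : S → ℝ) (p : S → A → ℝ) :
    M.VDBDualFeasible lb ub π d p ↔
      M.IsVDBFeasible lb ub π ∧ d = M.stateVisit π ∧ p = M.actionVisit π := by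
  constructor
  · rintro ⟨hd, -, hp, hb⟩
    have h1 : d = M.stateVisit π := M.eq_stateVisit hπ fun s => by
      simpa only [hp] using hd s
    have h2 : p = M.actionVisit π := by
      ext s a
      rw [hp, h1, actionVisit]
    subst h1 h2
    exact ⟨⟨hπ, hb⟩, rfl, rfl⟩
  · rintro ⟨⟨-, hb⟩, rfl, rfl⟩
    exact ⟨M.stateVisit_flow hπ, M.stateVisit_nonneg hπ, fun _ _ => rfl, hb⟩

theorem vdbDualValue_of_feasible {lb ub π : S → A → ℝ} (h : M.IsVDBFeasible lb ub π) :
    M.vdbDualValue lb ub π = M.avgReward π := by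
  rw [M.avgReward_eq h.1]
  refine le_antisymm (iSup_le fun d => iSup_le fun p => iSup_le fun hdp => ?_) ?_
  · rw [((M.vdbDualFeasible_iff h.1 lb ub d p).mp hdp).2.2]
  · exact le_iSup_of_le (M.stateVisit π) (le_iSup_of_le (M.actionVisit π)
      (le_iSup_of_le ((M.vdbDualFeasible_iff h.1 lb ub _ _).mpr ⟨h, rfl, rfl⟩) le_rfl))

theorem vdbDualValue_of_not_feasible {lb ub π : S → A → ℝ} (hπ : IsPolicy π)
    (h : ¬ M.IsVDBFeasible lb ub π) : M.vdbDualValue lb ub π = ⊥ :=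
  le_bot_iff.mp (iSup_le fun d => iSup_le fun p => iSup_le fun hdp =>
    absurd ((M.vdbDualFeasible_iff hπ lb ub d p).mp hdp).1 h)

/-- Weak duality: each slackness sum in `vdbPrimalObj_eq` is nonnegative. -/
theorem avgReward_le_vdbPrimalObj {lb ub π : S → A → ℝ} (h : M.IsVDBFeasible lb ub π)
    {x : VDBPrimalVars S A} (hx : M.VDBPrimalFeasible π x) :
    M.avgReward π ≤ M.vdbPrimalObj lb ub x := by
  rw [M.vdbPrimalObj_eq h.1 lb ub hx.2.1]
  have h1 : 0 ≤ ∑ s, M.stateVisit π s * (x.v s - ∑ a, π s a * x.q s a) :=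
    Finset.sum_nonneg fun s _ =>
      mul_nonneg (M.stateVisit_nonneg h.1 s) (sub_nonneg.mpr (hx.1 s))
  have h2 : 0 ≤ ∑ s, ∑ a, x.rLower s a * (M.actionVisit π s a - lb s a) :=
    Finset.sum_nonneg fun s _ => Finset.sum_nonneg fun a _ =>
      mul_nonneg (hx.2.2 s a).1 (sub_nonneg.mpr (h.2 s a).1)
  have h3 : 0 ≤ ∑ s, ∑ a, x.rUpper s a * (ub s a - M.actionVisit π s a) :=
    Finset.sum_nonneg fun s _ => Finset.sum_nonneg fun a _ =>
      mul_nonneg (hx.2.2 s a).2 (sub_nonneg.mpr (h.2 s a).2)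
  linarith

/-- For all reward modifications, the value functions give a point of the primal LP. -/
theorem exists_vdbPrimalFeasible {π : S → A → ℝ} (hπ : IsPolicy π) (lb ub : S → A → ℝ)
    {rLower rUpper : S → A → ℝ} (hL : ∀ s a, 0 ≤ rLower s a) (hU : ∀ s a, 0 ≤ rUpper s a) :
    ∃ x : VDBPrimalVars S A, M.VDBPrimalFeasible π x ∧ M.vdbPrimalObj lb ub x = M.avgReward π
      + ∑ s, ∑ a, rLower s a * (M.actionVisit π s a - lb s a)
      + ∑ s, ∑ a, rUpper s a * (ub s a - M.actionVisit π s a) := by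
  obtain ⟨v, hv⟩ := (M.modifyReward rLower rUpper).exists_bellman hπ
  let x : VDBPrimalVars S A := ⟨v, fun s a => ∑ s', M.trans s a s' *
      (M.reward s a s' + rLower s a - rUpper s a + M.disc * v s'), rLower, rUpper⟩
  have hx : ∀ s, x.v s = ∑ a, π s a * x.q s a := hv
  refine ⟨x, ⟨fun s => (hx s).ge, fun _ _ => rfl, fun s a => ⟨hL s a, hU s a⟩⟩, ?_⟩
  rw [M.vdbPrimalObj_eq hπ lb ub (fun _ _ => rfl)]
  simp only [fun s => sub_eq_zero.mpr (hx s), mul_zero, Finset.sum_const_zero, add_zero]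
  rfl

theorem vdbPrimalValue_of_feasible {lb ub π : S → A → ℝ} (h : M.IsVDBFeasible lb ub π) :
    M.vdbPrimalValue lb ub π = M.avgReward π := by
  refine le_antisymm ?_ (le_iInf fun x => le_iInf fun hx =>
    EReal.coe_le_coe_iff.mpr (M.avgReward_le_vdbPrimalObj h hx))
  obtain ⟨x, hx, hobj⟩ := M.exists_vdbPrimalFeasible h.1 lb ub
    (rLower := fun _ _ => 0) (rUpper := fun _ _ => 0) (fun _ _ => le_rfl) (fun _ _ => le_rfl)
  refine iInf_le_of_le x (iInf_le_of_le hx (EReal.coe_le_coe_iff.mpr ?_))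
  simp [hobj]

theorem vdbPrimalValue_of_not_feasible {lb ub π : S → A → ℝ} (hπ : IsPolicy π)
    (h : ¬ M.IsVDBFeasible lb ub π) : M.vdbPrimalValue lb ub π = ⊥ := by
  classical
  suffices hc : ∀ c : ℝ, ∃ x, M.VDBPrimalFeasible π x ∧ M.vdbPrimalObj lb ub x < c from
    EReal.eq_bot_iff_forall_lt _ |>.mpr fun c => by
      obtain ⟨x, hx, hlt⟩ := hc c
      exact (iInf₂_le x hx).trans_lt (EReal.coe_lt_coe_iff.mpr hlt)
  intro c
  simp only [IsVDBFeasible, hπ, true_and, not_forall, not_and_or, not_le] at h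
  obtain ⟨s, a, h⟩ := h
  -- A multiplier equal to `K` divided by the violation lowers the objective by exactly `K`, to
  -- below `c`.
  set K := |M.avgReward π - c| + 1 with hK
  have hKpos : 0 < K := by positivity
  have hKlt : M.avgReward π - K < c := by
    have := le_abs_self (M.avgReward π - c)
    linarith
  rcases h with h | h
  · obtain ⟨x, hx, hobj⟩ := M.exists_vdbPrimalFeasible hπ lb ub
      (rLower := Pi.single s (Pi.single a (K / (lb s a - M.actionVisit π s a))))
      (rUpper := fun _ _ => 0) (fun s' a' => by
        have h0 : 0 ≤ K / (lb s a - M.actionVisit π s a) := (div_pos hKpos (sub_pos.mpr h)).le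
        by_cases hs : s' = s
        · subst hs
          by_cases ha : a' = a
          · subst ha; simpa using h0
          · simp [ha]
        · simp [hs]) (fun _ _ => le_rfl)
    refine ⟨x, hx, ?_⟩
    rw [hobj, Finset.sum_eq_single s (by simp +contextual) (by simp),
      Finset.sum_eq_single a (by simp +contextual) (by simp)]
    simp only [Pi.single_eq_same, zero_mul, Finset.sum_const_zero, add_zero]
    rw [← neg_sub (lb s a), mul_neg, div_mul_cancel₀ _ (sub_pos.mpr h).ne']
    linarith
  · obtain ⟨x, hx, hobj⟩ := M.exists_vdbPrimalFeasible hπ lb ub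
      (rUpper := Pi.single s (Pi.single a (K / (M.actionVisit π s a - ub s a))))
      (rLower := fun _ _ => 0) (fun _ _ => le_rfl) (fun s' a' => by
        have h0 : 0 ≤ K / (M.actionVisit π s a - ub s a) := (div_pos hKpos (sub_pos.mpr h)).le
        by_cases hs : s' = s
        · subst hs
          by_cases ha : a' = a
          · subst ha; simpa using h0
          · simp [ha]
        · simp [hs])
    refine ⟨x, hx, ?_⟩
    rw [hobj, Finset.sum_eq_single (f := fun s' => ∑ a', _ * (ub s' a' - _)) s
        (by simp +contextual) (by simp),
      Finset.sum_eq_single (f := fun a' => _ * (ub s a' - _)) a (by simp +contextual) (by simp)]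
    simp only [Pi.single_eq_same, zero_mul, Finset.sum_const_zero, add_zero]
    rw [← neg_sub (M.actionVisit π s a), mul_neg, div_mul_cancel₀ _ (sub_pos.mpr h).ne']
    linarith

/-! ### Occupancy measures and existence of optimal policies. -/

/-- State-action densities that satisfy the flow equations and the bounds. -/
structure IsOccupancy (lb ub p : S → A → ℝ) : Prop where
  nonneg : ∀ s a, 0 ≤ p s a
  flow : ∀ s, ∑ a, p s a = (1 - M.disc) * M.initDist s
    + M.disc * ∑ s', ∑ a', p s' a' * M.trans s' a' s
  bounds : ∀ s a, lb s a ≤ p s a ∧ p s a ≤ ub s a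

theorem IsVDBFeasible.isOccupancy {M : FiniteMDP S A} {lb ub π : S → A → ℝ}
    (h : M.IsVDBFeasible lb ub π) : M.IsOccupancy lb ub (M.actionVisit π) :=
  ⟨M.actionVisit_nonneg h.1, fun s => by rw [M.sum_actionVisit h.1, M.stateVisit_flow h.1], h.2⟩

/-- Occupancy measures come from policies. -/
theorem IsOccupancy.exists_policy {M : FiniteMDP S A} {lb ub p π₀ : S → A → ℝ}
    (h : M.IsOccupancy lb ub p) (hπ₀ : IsPolicy π₀) :
    ∃ π, M.IsVDBFeasible lb ub π ∧ M.actionVisit π = p := by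
  classical
  -- Where `p` has no mass the choice of action is irrelevant, and `π₀` supplies a valid
  -- distribution.
  let π : S → A → ℝ := fun s a => if ∑ a', p s a' = 0 then π₀ s a else p s a / ∑ a', p s a'
  have hπ : IsPolicy π := by
    refine ⟨fun s => ?_, fun s a => ?_⟩
    · by_cases hs : ∑ a', p s a' = 0
      · simp only [π, hs, if_true, hπ₀.1]
      · simp only [π, hs, if_false, ← Finset.sum_div, div_self hs]
    · by_cases hs : ∑ a', p s a' = 0
      · simp only [π, hs, if_true, hπ₀.2]
      · simp only [π, hs, if_false]
        exact div_nonneg (h.nonneg s a) (Finset.sum_nonneg fun a' _ => h.nonneg s a')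
  have hp : ∀ s a, (∑ a', p s a') * π s a = p s a := by
    intro s a
    by_cases hs : ∑ a', p s a' = 0
    · rw [hs, zero_mul]
      exact ((Finset.sum_eq_zero_iff_of_nonneg fun a' _ => h.nonneg s a').mp hs a
        (Finset.mem_univ a)).symm
    · simp only [π, hs, if_false, mul_div_cancel₀ _ hs]
  have hd : (fun s => ∑ a, p s a) = M.stateVisit π := M.eq_stateVisit hπ fun s => by
    simp only [hp]
    exact h.flow s
  have hv : M.actionVisit π = p := by
    ext s a
    rw [actionVisit, ← hd, hp]
  exact ⟨π, ⟨hπ, hv ▸ h.bounds⟩, hv⟩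

theorem isCompact_isOccupancy (lb ub : S → A → ℝ) : IsCompact {p | M.IsOccupancy lb ub p} := by
  refine (isCompact_Icc (a := lb) (b := ub)).of_isClosed_subset ?_
    fun p hp => ⟨fun s a => (hp.bounds s a).1, fun s a => (hp.bounds s a).2⟩
  have h : {p | M.IsOccupancy lb ub p} = (⋂ s, ⋂ a, {p : S → A → ℝ | 0 ≤ p s a}) ∩
      (⋂ s, {p : S → A → ℝ | ∑ a, p s a = (1 - M.disc) * M.initDist s
        + M.disc * ∑ s', ∑ a', p s' a' * M.trans s' a' s}) ∩ Set.Icc lb ub := by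
    ext p
    simp only [Set.mem_inter_iff, Set.mem_iInter, Set.mem_ofPred_eq, Set.mem_Icc, Pi.le_def]
    exact ⟨fun h => ⟨⟨h.nonneg, h.flow⟩, fun s a => (h.bounds s a).1, fun s a => (h.bounds s a).2⟩,
      fun h => ⟨h.1.1, h.1.2, fun s a => ⟨h.2.1 s a, h.2.2 s a⟩⟩⟩
  rw [h]
  refine (IsClosed.inter ?_ ?_).inter isClosed_Icc
  · exact isClosed_iInter fun s => isClosed_iInter fun a =>
      isClosed_le continuous_const (by fun_prop)
  · exact isClosed_iInter fun s => isClosed_eq (by fun_prop) (by fun_prop)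

theorem exists_isVDBOptimal {lb ub π₀ : S → A → ℝ} (h₀ : M.IsVDBFeasible lb ub π₀) :
    ∃ π, M.IsVDBOptimal lb ub π := by
  obtain ⟨p, hp, hmax⟩ := (M.isCompact_isOccupancy lb ub).exists_isMaxOn
    ⟨_, h₀.isOccupancy⟩ (f := M.vdbDualObj) (by unfold vdbDualObj; fun_prop)
  obtain ⟨π, hπ, rfl⟩ := IsOccupancy.exists_policy hp h₀.1
  refine ⟨π, hπ, fun π' hπ' => ?_⟩
  rw [M.avgReward_eq hπ.1, M.avgReward_eq hπ'.1]
  exact hmax hπ'.isOccupancy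

/-- Stated for abstract `J` to serve both LP forms; excluding the value `⊥` forces feasibility. -/
theorem isPOOptimal_iff {J : (S → A → ℝ) → EReal} {lb ub : S → A → ℝ}
    (h1 : ∀ π, M.IsVDBFeasible lb ub π → J π = M.avgReward π)
    (h2 : ∀ π, IsPolicy π → ¬ M.IsVDBFeasible lb ub π → J π = ⊥) (π : S → A → ℝ) :
    IsPOOptimal J π ↔ M.IsVDBOptimal lb ub π := by
  constructor
  · rintro ⟨hπ, hbot, hmax⟩
    have hf : M.IsVDBFeasible lb ub π := by_contra fun hf => hbot (h2 π hπ hf)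
    refine ⟨hf, fun π' hπ' => ?_⟩
    have := hmax π' hπ'.1
    rwa [h1 π hf, h1 π' hπ', EReal.coe_le_coe_iff] at this
  · rintro ⟨hf, hmax⟩
    refine ⟨hf.1, by rw [h1 π hf]; exact EReal.coe_ne_bot _, fun π' hπ' => ?_⟩
    by_cases hf' : M.IsVDBFeasible lb ub π'
    · rw [h1 π hf, h1 π' hf', EReal.coe_le_coe_iff]
      exact hmax π' hf'
    · rw [h2 π' hπ' hf']
      exact bot_le

/-! ### Multipliers at an optimal occupancy measure. -/

/-- The net flow out of state `s` as a linear functional of the state-action densities. -/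
def flowFunctional (s : S) : (S → A → ℝ) →ₗ[ℝ] ℝ where
  toFun p := ∑ a, p s a - M.disc * ∑ s', ∑ a', p s' a' * M.trans s' a' s
  map_add' p p' := by
    simp only [Pi.add_apply, add_mul, Finset.sum_add_distrib]
    ring
  map_smul' c p := by
    simp only [Pi.smul_apply, smul_eq_mul, RingHom.id_apply, mul_assoc, ← Finset.mul_sum]
    ring

/-- The dual objective as a linear functional. -/
def objFunctional : (S → A → ℝ) →ₗ[ℝ] ℝ where
  toFun p := M.vdbDualObj p
  map_add' p p' := by
    simp only [vdbDualObj, Pi.add_apply, add_mul, Finset.sum_add_distrib]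
  map_smul' c p := by
    simp only [vdbDualObj, Pi.smul_apply, smul_eq_mul, RingHom.id_apply, mul_assoc,
      ← Finset.mul_sum]

/-- Active inequalities survive by the sign of `δ`, inactive ones by continuity for small `t`. -/
theorem IsOccupancy.eventually_add_smul {M : FiniteMDP S A} {lb ub p δ : S → A → ℝ}
    (hp : M.IsOccupancy lb ub p) (hflow : ∀ s, M.flowFunctional s δ = 0)
    (hL : ∀ s a, p s a = lb s a → 0 ≤ δ s a) (hU : ∀ s a, p s a = ub s a → δ s a ≤ 0)
    (hN : ∀ s a, p s a = 0 → 0 ≤ δ s a) :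
    ∀ᶠ t in 𝓝[>] (0 : ℝ), M.IsOccupancy lb ub (p + t • δ) := by
  have key : ∀ b x y : ℝ, b ≤ x → (x = b → 0 ≤ y) → ∀ᶠ t in 𝓝[>] (0 : ℝ), b ≤ x + t * y := by
    intro b x y hbx hy
    rcases hbx.eq_or_lt with h | h
    · filter_upwards [self_mem_nhdsWithin] with t ht
      have := mul_nonneg (le_of_lt (Set.mem_Ioi.mp ht)) (hy h.symm)
      linarith
    · have hc : Tendsto (fun t : ℝ => x + t * y) (𝓝 0) (𝓝 (x + 0 * y)) :=
        Continuous.tendsto (by fun_prop) 0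
      rw [zero_mul, add_zero] at hc
      exact ((hc.mono_left nhdsWithin_le_nhds).eventually_const_lt h).mono fun t ht => ht.le
  have e1 : ∀ᶠ t in 𝓝[>] (0 : ℝ), ∀ s a, 0 ≤ p s a + t * δ s a :=
    eventually_all.mpr fun s => eventually_all.mpr fun a => key _ _ _ (hp.nonneg s a) (hN s a)
  have e2 : ∀ᶠ t in 𝓝[>] (0 : ℝ), ∀ s a, lb s a ≤ p s a + t * δ s a :=
    eventually_all.mpr fun s => eventually_all.mpr fun a =>
      key _ _ _ (hp.bounds s a).1 (hL s a)
  have e3 : ∀ᶠ t in 𝓝[>] (0 : ℝ), ∀ s a, -ub s a ≤ -p s a + t * -δ s a :=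
    eventually_all.mpr fun s => eventually_all.mpr fun a =>
      key _ _ _ (neg_le_neg (hp.bounds s a).2)
        fun h => neg_nonneg.mpr (hU s a (neg_injective h))
  filter_upwards [e1, e2, e3] with t h1 h2 h3
  refine ⟨h1, fun s => ?_, fun s a => ⟨h2 s a, ?_⟩⟩
  · have hδ := hflow s
    have hs : M.flowFunctional s (p + t • δ) = M.flowFunctional s p := by
      rw [map_add, map_smul, hδ, smul_zero, add_zero]
    have h0 := hp.flow s
    simp only [flowFunctional, LinearMap.coe_mk, AddHom.coe_mk] at hs
    linarith
  · have := h3 s a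
    simp only [Pi.add_apply, Pi.smul_apply, smul_eq_mul]
    linarith

/-- Multipliers with complementary slackness at an occupancy measure of maximal reward. -/
theorem IsOccupancy.exists_multipliers {M : FiniteMDP S A} {lb ub p : S → A → ℝ}
    (hp : M.IsOccupancy lb ub p)
    (hmax : ∀ p', M.IsOccupancy lb ub p' → M.vdbDualObj p' ≤ M.vdbDualObj p) :
    ∃ (v : S → ℝ) (rLower rUpper slack : S → A → ℝ), ∀ s a,
      (0 ≤ rLower s a ∧ 0 ≤ rUpper s a ∧ 0 ≤ slack s a) ∧
      (rLower s a * (p s a - lb s a) = 0 ∧ rUpper s a * (ub s a - p s a) = 0 ∧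
        p s a * slack s a = 0) ∧
      ∑ s', M.trans s a s' * (M.reward s a s' + rLower s a - rUpper s a + M.disc * v s')
        = v s - slack s a := by
  classical
  let E : S × A → (S → A → ℝ) →ₗ[ℝ] ℝ := fun i => LinearMap.proj i.2 ∘ₗ LinearMap.proj i.1
  -- Indicators of the active constraints. Multiplying the Farkas coefficients by them makes
  -- complementary slackness automatic.
  let wL : S × A → ℝ := fun i => if p i.1 i.2 = lb i.1 i.2 then 1 else 0
  let wU : S × A → ℝ := fun i => if p i.1 i.2 = ub i.1 i.2 then 1 else 0
  let wN : S × A → ℝ := fun i => if p i.1 i.2 = 0 then 1 else 0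
  -- Each flow equality enters as two inequalities, so `v` is a difference of coefficients and has
  -- no sign. The premise holds since a feasible direction cannot improve a maximizer.
  obtain ⟨c, hc, hg⟩ := farkas
    (Sum.elim M.flowFunctional (Sum.elim (fun s => -M.flowFunctional s)
      (Sum.elim (fun i => -wL i • E i) (Sum.elim (fun i => wU i • E i) (fun i => -wN i • E i)))))
    M.objFunctional (fun δ hδ => by
      simp only [Sum.forall, Sum.elim_inl, Sum.elim_inr, LinearMap.neg_apply,
        LinearMap.smul_apply, smul_eq_mul] at hδ
      obtain ⟨h1, h2, h3, h4, h5⟩ := hδ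
      have hev := hp.eventually_add_smul (δ := δ)
        (fun s => le_antisymm (h1 s) (neg_nonpos.mp (h2 s)))
        (fun s a h => by simpa [wL, E, h] using h3 (s, a))
        (fun s a h => by simpa [wU, E, h] using h4 (s, a))
        (fun s a h => by simpa [wN, E, h] using h5 (s, a))
      obtain ⟨t, ht, ht0⟩ := (hev.and self_mem_nhdsWithin).exists
      have h6 : M.objFunctional (p + t • δ) ≤ M.objFunctional p := hmax _ ht
      rw [map_add, map_smul, smul_eq_mul] at h6
      exact nonpos_of_mul_nonpos_right (by linarith) ht0)
  refine ⟨fun s => c (.inl s) - c (.inr (.inl s)),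
    fun s a => c (.inr (.inr (.inl (s, a)))) * wL (s, a),
    fun s a => c (.inr (.inr (.inr (.inl (s, a))))) * wU (s, a),
    fun s a => c (.inr (.inr (.inr (.inr (s, a))))) * wN (s, a), fun s a => ⟨⟨?_, ?_, ?_⟩,
      ⟨?_, ?_, ?_⟩, ?_⟩⟩
  · exact mul_nonneg (hc _) (by simp only [wL]; split_ifs <;> norm_num)
  · exact mul_nonneg (hc _) (by simp only [wU]; split_ifs <;> norm_num)
  · exact mul_nonneg (hc _) (by simp only [wN]; split_ifs <;> norm_num)
  · by_cases h : p s a = lb s a <;> simp [wL, h]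
  · by_cases h : p s a = ub s a <;> simp [wU, h]
  · by_cases h : p s a = 0 <;> simp [wN, h]
  · have hE : ∀ i : S × A, E i (Pi.single s (Pi.single a 1)) = if i = (s, a) then 1 else 0 := by
      rintro ⟨s', a'⟩
      by_cases hs : s' = s
      · subst hs
        by_cases ha : a' = a <;> simp [E, ha]
      · simp [E, hs]
    have hF : ∀ s', M.flowFunctional s' (Pi.single s (Pi.single a 1))
        = (if s' = s then 1 else 0) - M.disc * M.trans s a s' := by
      intro s'
      simp only [flowFunctional, LinearMap.coe_mk, AddHom.coe_mk]
      congr 1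
      · by_cases hs : s' = s
        · subst hs; simp
        · simp [hs]
      · rw [Finset.sum_eq_single s (by simp +contextual) (by simp),
          Finset.sum_eq_single a (by simp +contextual) (by simp)]
        simp
    have hO : M.objFunctional (Pi.single s (Pi.single a 1))
        = ∑ s', M.trans s a s' * M.reward s a s' := by
      simp only [objFunctional, LinearMap.coe_mk, AddHom.coe_mk, vdbDualObj]
      rw [Finset.sum_eq_single s (by simp +contextual) (by simp),
        Finset.sum_eq_single a (by simp +contextual) (by simp)]
      simp
    have h := hg (Pi.single s (Pi.single a 1))
    simp only [Fintype.sum_sum_type, Sum.elim_inl, Sum.elim_inr, LinearMap.neg_apply,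
        LinearMap.smul_apply, smul_eq_mul, hE, hF, hO, mul_ite, mul_one, mul_zero, mul_sub,
        Finset.sum_sub_distrib, Finset.sum_ite_eq', Finset.mem_univ, if_true, mul_neg,
        neg_sub] at h
    simp only [mul_add, mul_sub, Finset.sum_add_distrib, Finset.sum_sub_distrib,
      ← Finset.sum_mul, M.trans_sum, one_mul]
    have h7 : ∀ w : S → ℝ, ∑ s', w s' * (M.disc * M.trans s a s')
        = ∑ s', M.trans s a s' * (M.disc * w s') :=
      fun w => Finset.sum_congr rfl fun s' _ => by ring
    simp only [h7] at h
    rw [h]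
    ring

end FiniteMDP

/-! ### The main theorem. -/

theorem mainTheorem8 {S A : Type*} [Fintype S] [Fintype A] (M : FiniteMDP S A)
    (lb ub : S → A → ℝ) :
    -- the nested problem, with the inner LP in its primal or in its dual form, has exactly
    -- the optimal policies of the MDP with visitation density bounds as optimal solutions
    (∀ π : S → A → ℝ, IsPOOptimal (M.vdbPrimalValue lb ub) π ↔ M.IsVDBOptimal lb ub π) ∧
    (∀ π : S → A → ℝ, IsPOOptimal (M.vdbDualValue lb ub) π ↔ M.IsVDBOptimal lb ub π) ∧
    -- an optimal solution exists as soon as some policy satisfies the bounds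
    ((∃ π : S → A → ℝ, M.IsVDBFeasible lb ub π) →
      ∃ π : S → A → ℝ, IsPOOptimal (M.vdbPrimalValue lb ub) π) ∧
    -- if every state has positive initial probability, an optimal solution is greedy with
    -- respect to its adjusted value function, for suitable optimal reward modifications
    ((∀ s, 0 < M.initDist s) →
      ∀ π : S → A → ℝ, IsPOOptimal (M.vdbPrimalValue lb ub) π →
        ∃ x : VDBPrimalVars S A, M.IsVDBPrimalOptimal lb ub π x ∧
          x.v = (M.modifyReward x.rLower x.rUpper).stateValue π ∧
          x.q = (M.modifyReward x.rLower x.rUpper).actionValue π ∧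
          (∀ s, IsGreatest (Set.range (x.q s)) (x.v s)) ∧
          ∀ s a, 0 < π s a → ∀ a', x.q s a' ≤ x.q s a) := by
  have hP := M.isPOOptimal_iff (lb := lb) (ub := ub)
    (fun π => M.vdbPrimalValue_of_feasible) (fun π => M.vdbPrimalValue_of_not_feasible)
  have hD := M.isPOOptimal_iff (lb := lb) (ub := ub)
    (fun π => M.vdbDualValue_of_feasible) (fun π => M.vdbDualValue_of_not_feasible)
  refine ⟨hP, hD, fun ⟨π₀, h₀⟩ => ?_, fun hι π hopt => ?_⟩
  · obtain ⟨π, hπ⟩ := M.exists_isVDBOptimal h₀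
    exact ⟨π, (hP π).mpr hπ⟩
  obtain ⟨hf, hmax⟩ := (hP π).mp hopt
  -- Every occupancy measure comes from a policy, so optimality among policies passes to the whole
  -- polytope.
  obtain ⟨v, rL, rU, sl, h⟩ := hf.isOccupancy.exists_multipliers (fun p' hp' => by
    obtain ⟨π', hπ', rfl⟩ := hp'.exists_policy hf.1
    rw [← M.avgReward_eq hf.1, ← M.avgReward_eq hπ'.1]
    exact hmax π' hπ')
  have hd : ∀ s, 0 < M.stateVisit π s := fun s => by
    rw [M.stateVisit_flow hf.1]
    exact add_pos_of_pos_of_nonneg (mul_pos (sub_pos.mpr M.disc_lt_one) (hι s))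
      (mul_nonneg M.disc_nonneg (Finset.sum_nonneg fun s' _ => Finset.sum_nonneg fun a' _ =>
        mul_nonneg (M.actionVisit_nonneg hf.1 s' a') (M.trans_nonneg _ _ _)))
  have hsl : ∀ s a, π s a * sl s a = 0 := fun s a => by
    have h1 := (h s a).2.1.2.2
    rw [FiniteMDP.actionVisit, mul_assoc] at h1
    exact (mul_eq_zero.mp h1).resolve_left (hd s).ne'
  let x : VDBPrimalVars S A := ⟨v, fun s a => ∑ s', M.trans s a s' *
      (M.reward s a s' + rL s a - rU s a + M.disc * v s'), rL, rU⟩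
  have hq : ∀ s a, x.q s a = v s - sl s a := fun s a => (h s a).2.2
  have hle : ∀ s a, x.q s a ≤ v s := fun s a => by
    rw [hq]
    exact sub_le_self _ (h s a).1.2.2
  have heq : ∀ s a, 0 < π s a → x.q s a = v s := fun s a ha => by
    rw [hq, (mul_eq_zero.mp (hsl s a)).resolve_left ha.ne', sub_zero]
  have hv : ∀ s, v s = ∑ a, π s a * x.q s a := fun s => by
    simp only [hq, mul_sub, hsl, sub_zero, ← Finset.sum_mul, hf.1.1, one_mul]
  have hx : M.VDBPrimalFeasible π x :=
    ⟨fun s => (hv s).ge, fun _ _ => rfl, fun s a => ⟨(h s a).1.1, (h s a).1.2.1⟩⟩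
  refine ⟨x, ⟨hx, fun y hy => ?_⟩,
    ((M.modifyReward rL rU).stateValue_eq hf.1 hv).symm, ?_, fun s => ⟨?_, ?_⟩,
    fun s a ha a' => (hle s a').trans_eq (heq s a ha).symm⟩
  -- All slackness terms vanish at `x`, so weak duality is attained.
  · refine le_trans (le_of_eq ?_) (M.avgReward_le_vdbPrimalObj hf hy)
    rw [M.vdbPrimalObj_eq hf.1 lb ub hx.2.1]
    simp only [x] at hv ⊢
    simp only [← hv, (h _ _).2.1.1, (h _ _).2.1.2.1, sub_self, mul_zero, Finset.sum_const_zero,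
      add_zero]
  · ext s a
    exact ((M.modifyReward rL rU).actionValue_eq hf.1 hv s a).symm
  -- Some action has positive probability, and it attains the maximum.
  · obtain ⟨a, -, ha⟩ := Finset.exists_lt_of_sum_lt (s := Finset.univ) (f := fun _ => (0 : ℝ))
      (g := π s) (by simp [hf.1.1])
    exact ⟨a, heq s a ha⟩
  · rintro _ ⟨a, rfl⟩
    exact hle s a
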